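/- **Theorem (max-plus Sierksma / Dutch cheese).** Let $\mathbb{R}_{\max}=\mathbb{R}\cup\{-\infty\}$. For finitely many points $x_i$ ($i\in I$) of $\mathbb{R}_{\max}^d$, let $\mathrm{mpconv}\{x_i : i\in I\}$ be the set of all points $\max_{i\in I}(\lambda_i+x_i)$ (sums and maxima taken componentwise) with $\lambda_i\in\mathbb{R}_{\max}$ and $\max_{i\in I}\lambda_i=0$. Let $q\ge 2$, $d\ge 1$ and $N=(d+1)(q-1)$, and let $x_1,\dots,x_{N+1}$ be points of $\mathbb{R}_{\max}^d$ (not necessarily distinct). Then there are at least $((q-1)!)^d$ unordered max-plus Tverberg partitions, that is, unordered partitions of the index set $\{1,\dots,N+1\}$ into $q$ nonempty subsets $I_1,\dots,I_q$ such that $$\bigcap_{l=1}^{q}\mathrm{mpconv}\{x_i : i\in I_l\}\neq\emptyset .$$ -/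

import Mathlib

open scoped Nat

/-- The max-plus semiring's underlying set `ℝ ∪ {-∞}`, with `⊥` as `-∞`; addition of `WithBot ℝ`
satisfies `⊥ + a = a + ⊥ = ⊥`. -/
abbrev RMax : Type := WithBot ℝ

/-- The max-plus convex hull of the points `x i`, `i ∈ s`, in `RMax ^ d`: all `y` of the form
`max_{i ∈ s} (c i + x i)` (componentwise) with coefficients `c i` in `RMax` satisfying
`max_{i ∈ s} c i = 0`. The maximum over a finset is `Finset.sup`, whose value on the empty finset
is `⊥`; hence the hull of the empty family is empty. -/
def mpconv {ι : Type*} {d : ℕ} (s : Finset ι) (x : ι → Fin d → RMax) : Set (Fin d → RMax) :=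
  {y | ∃ c : ι → RMax, (s.sup c = 0) ∧ ∀ j : Fin d, y j = s.sup (fun i => c i + x i j)}

/-- A max-plus Tverberg partition into `q` subsets of the finite family of points `x`: an unordered
partition of the index set into exactly `q` nonempty parts, such that the max-plus convex hulls of
the corresponding `q` subfamilies have a common point. -/
def IsMPTverbergPartition {ι : Type*} [Fintype ι] [DecidableEq ι] {d : ℕ} (q : ℕ)
    (x : ι → Fin d → RMax) (P : Finpartition (Finset.univ : Finset ι)) : Prop :=
  P.parts.card = q ∧ ∃ y : Fin d → RMax, ∀ s ∈ P.parts, y ∈ mpconv s x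

/-! Exponentiate, so that -∞ becomes 0 and max-plus hulls become hulls for max and times. Add a
homogenising coordinate equal to 1, giving `d + 1` rows (coordinates) against `(d + 1) * (q - 1) +
1` columns (points). The core is a common scaling: coefficients `c i` and a point `Y` with `c i * X
i j ≤ Y j`, where each row `j` has a set `A j` of `q` tight columns and the incidences form a
forest. If a `q`-colouring of the columns is rainbow on every `A j`, each colour class attains `Y`
in every coordinate, so `Y` lies in all the hulls.

The scaling is linear programming duality (`exists_potential_tight_forest`). An optimal transport
plan of minimal support is supported on a forest. The marginals give each row at least `q` support
edges, so the support is a spanning tree; it determines dual potentials, and optimality makes them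
feasible. Zero entries are handled by a limit.

In a forest the rainbow conditions act independently (`IsBipartiteForest.card_rainbow_mul_pow`):
each row keeps the fraction `(q-1)! / q^(q-1)` of the colourings. This leaves `q ! * ((q-1)!)^d`
colourings, and at most `q !` of them induce the same partition. -/

/-- An edge set of a bipartite graph is a forest if every nonempty set of its edges spans more
vertices than it has edges. -/
def IsBipartiteForest {C R : Type*} [DecidableEq C] [DecidableEq R] (E : Finset (C × R)) : Prop :=
  ∀ F ⊆ E, F.Nonempty → F.card < (F.image Prod.fst).card + (F.image Prod.snd).card

/-! ### Counting rainbow colourings of a forest -/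

/-- A set of colourings that is closed under recolouring `b` splits evenly according to the
colour of `b`. -/
theorem card_filter_notMem_image_mul {C : Type*} [Fintype C] [DecidableEq C] {q : ℕ}
    (S : Finset (C → Fin q)) (b : C) (hS : ∀ g ∈ S, ∀ v, Function.update g b v ∈ S)
    (K : Finset C) (hb : b ∉ K) (hK : ∀ g ∈ S, Set.InjOn g K) :
    (S.filter fun g => g b ∉ K.image g).card * q = S.card * (q - K.card) := by
  -- Exchange the colour of `b` with a spare colour `v`: the pair (good colouring, any colour)
  -- becomes (any colouring, colour avoiding `K`), and the same exchange undoes it.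
  have h1 : ((S.filter fun g => g b ∉ K.image g) ×ˢ (Finset.univ : Finset (Fin q))).card =
      (S.sigma fun g => (Finset.univ \ K.image g : Finset (Fin q))).card := by
    refine Finset.card_bij' (fun p _ => ⟨Function.update p.1 b p.2, p.1 b⟩)
      (fun p _ => (Function.update p.1 b p.2, p.1 b)) ?_ ?_ ?_ ?_
    · rintro ⟨g, v⟩ h
      simp only [Finset.mem_product, Finset.mem_filter, Finset.mem_univ, and_true] at h
      simp only [Finset.mem_sigma, Finset.mem_sdiff, Finset.mem_univ, true_and]
      refine ⟨hS _ h.1 _, ?_⟩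
      rw [Finset.image_congr (g := g)]
      · exact h.2
      · intro i hi
        exact Function.update_of_ne (ne_of_mem_of_not_mem hi hb) _ _
    · rintro ⟨g, v⟩ h
      simp only [Finset.mem_sigma, Finset.mem_sdiff, Finset.mem_univ, true_and] at h
      simp only [Finset.mem_product, Finset.mem_filter, Finset.mem_univ, and_true]
      refine ⟨hS _ h.1 _, ?_⟩
      rw [Finset.image_congr (g := g), Function.update_self]
      · exact h.2
      · intro i hi
        exact Function.update_of_ne (ne_of_mem_of_not_mem hi hb) _ _
    · rintro ⟨g, v⟩ h
      simp
    · rintro ⟨g, v⟩ h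
      simp
  rw [Finset.card_product, Finset.card_univ, Fintype.card_fin] at h1
  rw [h1, Finset.card_sigma, Finset.sum_const_nat]
  intro g hg
  rw [Finset.card_sdiff_of_subset (Finset.subset_univ _), Finset.card_univ, Fintype.card_fin,
    Finset.card_image_of_injOn (hK g hg)]

/-- The number of colourings in `S` that are injective on `K ∪ B`, where `S` is closed under
recolouring `B` and all its members are injective on `K`. -/
theorem card_filter_injOn_union_mul_pow {C : Type*} [Fintype C] [DecidableEq C] {q : ℕ}
    (B : Finset C) : ∀ (S : Finset (C → Fin q)) (K : Finset C),
    (∀ g ∈ S, ∀ b ∈ B, ∀ v, Function.update g b v ∈ S) → Disjoint K B →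
    (∀ g ∈ S, Set.InjOn g K) →
    (S.filter fun g => Set.InjOn g ((K ∪ B : Finset C) : Set C)).card * q ^ B.card =
      S.card * (q - K.card).descFactorial B.card := by
  classical
  induction B using Finset.induction_on with
  | empty =>
    intro S K _ _ hK
    simp only [Finset.union_empty, Finset.card_empty, pow_zero, mul_one, Nat.descFactorial_zero]
    rw [Finset.filter_true_of_mem hK]
  | insert b B hb ih =>
    intro S K hS hd hK
    have hbK : b ∉ K := fun h => Finset.disjoint_left.1 hd h (Finset.mem_insert_self _ _)
    have hinj : ∀ g ∈ S, (Set.InjOn g ((insert b K : Finset C) : Set C) ↔ g b ∉ K.image g) := by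
      intro g hg
      rw [Finset.coe_insert, Set.injOn_insert (by simpa using hbK)]
      simp [hK g hg]
    have h1 := card_filter_notMem_image_mul S b
      (fun g hg v => hS g hg b (Finset.mem_insert_self _ _) v) K hbK hK
    have h2 := ih (S.filter fun g => g b ∉ K.image g) (insert b K) (by
        intro g hg b' hb' v
        rw [Finset.mem_filter] at hg ⊢
        have hb'K : b' ∉ K := fun h =>
          Finset.disjoint_left.1 hd h (Finset.mem_insert_of_mem hb')
        refine ⟨hS g hg.1 b' (Finset.mem_insert_of_mem hb') v, ?_⟩
        have him : K.image (Function.update g b' v) = K.image g :=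
          Finset.image_congr fun i hi => Function.update_of_ne (ne_of_mem_of_not_mem hi hb'K) _ _
        rw [Function.update_of_ne (ne_of_mem_of_not_mem hb' hb).symm, him]
        exact hg.2) (by
        rw [Finset.disjoint_insert_left]
        exact ⟨hb, hd.mono_right (Finset.subset_insert _ _)⟩) (by
        intro g hg
        rw [Finset.mem_filter] at hg
        exact (hinj g hg.1).2 hg.2)
    have h3 : (S.filter fun g => Set.InjOn g ((K ∪ insert b B : Finset C) : Set C)) =
        ((S.filter fun g => g b ∉ K.image g).filter
          fun g => Set.InjOn g ((insert b K ∪ B : Finset C) : Set C)) := by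
      ext g
      simp only [Finset.mem_filter, and_assoc]
      refine and_congr_right fun hg => ?_
      have e : K ∪ insert b B = insert b K ∪ B := by
        rw [Finset.union_insert, Finset.insert_union]
      rw [e]
      refine ⟨fun h => ⟨(hinj g hg).1 (h.mono ?_), h⟩, fun h => h.2⟩
      exact_mod_cast Finset.subset_union_left
    rw [h3, Finset.card_insert_of_notMem hb, pow_succ, ← mul_assoc, h2,
      Finset.card_insert_of_notMem hbK, mul_right_comm, h1]
    -- When `q ≤ K.card` the truncated subtraction makes both sides zero.
    have e2 : (q - K.card).descFactorial (B.card + 1) =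
        (q - K.card) * (q - (K.card + 1)).descFactorial B.card := by
      rcases Nat.eq_zero_or_pos (q - K.card) with h0 | h0
      · rw [h0]; simp
      · obtain ⟨m, hm⟩ := Nat.exists_eq_add_of_lt h0
        have : q - (K.card + 1) = m := by omega
        rw [this, show q - K.card = m + 1 by omega, Nat.succ_descFactorial_succ]
    rw [e2]; ring

/-- In a forest some row shares at most one column with the other rows. -/
theorem IsBipartiteForest.exists_card_inter_biUnion_le_one {C R : Type*} [DecidableEq C]
    [DecidableEq R] (A : R → Finset C) (J : Finset R) (hJ : J.Nonempty)
    (hA : IsBipartiteForest ((J.sigma A).image fun p => (p.2, p.1))) :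
    ∃ j ∈ J, (A j ∩ (J.erase j).biUnion A).card ≤ 1 := by
  -- Otherwise keep only the incidences `F` with shared columns. Every row has degree at least 2 in
  -- `F`, and so does every column that occurs, so `F` has at least as many edges as vertices.
  by_contra! hcon
  set D : R → Finset C := fun j => A j ∩ (J.erase j).biUnion A with hD
  set F : Finset (C × R) := (J.sigma D).image fun p => (p.2, p.1) with hF
  have memF : ∀ i j, (i, j) ∈ F ↔ j ∈ J ∧ i ∈ D j := by
    intro i j
    simp only [hF, Finset.mem_image, Finset.mem_sigma, Prod.mk.injEq, Sigma.exists]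
    constructor
    · rintro ⟨a, b, h, rfl, rfl⟩; exact h
    · intro h; exact ⟨j, i, h, rfl, rfl⟩
  have hcard : F.card = ∑ j ∈ J, (D j).card := by
    rw [hF, Finset.card_image_of_injective, Finset.card_sigma]
    rintro ⟨a, b⟩ ⟨a', b'⟩ h
    simp only [Prod.mk.injEq] at h
    obtain ⟨rfl, rfl⟩ := h
    rfl
  have h1 : 2 * J.card ≤ F.card := by
    rw [hcard, mul_comm]
    exact Finset.card_nsmul_le_sum J _ 2 fun j hj => hcon j hj
  have h2 : 2 * (F.image Prod.fst).card ≤ F.card := by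
    refine Finset.mul_card_image_le_card F 2 ?_
    intro i hi
    obtain ⟨⟨i', j⟩, hij, rfl⟩ := Finset.mem_image.1 hi
    obtain ⟨hj, hi'⟩ := (memF _ _).1 hij
    obtain ⟨hiA, hiU⟩ := Finset.mem_inter.1 hi'
    obtain ⟨j', hj', hiA'⟩ := Finset.mem_biUnion.1 hiU
    obtain ⟨hne, hj'J⟩ := Finset.mem_erase.1 hj'
    have hij' : (i', j') ∈ F := (memF _ _).2 ⟨hj'J, Finset.mem_inter.2 ⟨hiA',
      Finset.mem_biUnion.2 ⟨j, Finset.mem_erase.2 ⟨hne.symm, hj⟩, hiA⟩⟩⟩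
    refine Finset.one_lt_card.2 ⟨(i', j), Finset.mem_filter.2 ⟨hij, rfl⟩, (i', j'),
      Finset.mem_filter.2 ⟨hij', rfl⟩, ?_⟩
    simpa using hne.symm
  have h3 : (F.image Prod.snd).card ≤ J.card := by
    refine Finset.card_le_card ?_
    intro j hj
    obtain ⟨⟨i, j⟩, hij, rfl⟩ := Finset.mem_image.1 hj
    exact ((memF _ _).1 hij).1
  have h4 := hA F (Finset.image_subset_image
    (Finset.sigma_mono (Finset.Subset.refl _) fun j => Finset.inter_subset_left))
    (Finset.card_pos.1 (by have := hJ.card_pos; omega))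
  omega

theorem IsBipartiteForest.mono {C R : Type*} [DecidableEq C] [DecidableEq R]
    {E F : Finset (C × R)} (hE : IsBipartiteForest E) (h : F ⊆ E) : IsBipartiteForest F :=
  fun G hG => hE G (hG.trans h)

/-- The number of colourings of the columns that are rainbow at each row of a forest all of whose
rows have degree `q`. -/
theorem IsBipartiteForest.card_rainbow_mul_pow {C R : Type*} [Fintype C] [DecidableEq C]
    [DecidableEq R] {q : ℕ} (A : R → Finset C) (hq : 0 < q) (hcard : ∀ j, (A j).card = q)
    (n : ℕ) : ∀ J : Finset R, J.card = n →
    IsBipartiteForest ((J.sigma A).image fun p => (p.2, p.1)) →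
    (Finset.univ.filter fun g : C → Fin q => ∀ j ∈ J, Set.InjOn g (A j)).card *
      (q ^ (q - 1)) ^ n = ((q - 1)!) ^ n * q ^ Fintype.card C := by
  classical
  induction n with
  | zero =>
    intro J hJ _
    obtain rfl := Finset.card_eq_zero.1 hJ
    simp
  | succ n ih =>
    intro J hJ hA
    obtain ⟨j, hj, hle⟩ := IsBipartiteForest.exists_card_inter_biUnion_le_one A J
      (Finset.card_pos.1 (by omega)) hA
    have hsd := Finset.card_sdiff_add_card_inter (A j) ((J.erase j).biUnion A)
    -- At least `q - 1` columns of row `j` are private to it. Recolouring them leaves the other rows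
    -- untouched, and injectivity on the single remaining column is automatic.
    obtain ⟨B, hB, hBcard⟩ := Finset.exists_subset_card_eq
      (s := A j \ (J.erase j).biUnion A) (n := q - 1) (by have := hcard j; omega)
    have hBA : B ⊆ A j := hB.trans Finset.sdiff_subset
    have hK : (A j \ B).card = 1 := by
      rw [Finset.card_sdiff_of_subset hBA, hcard, hBcard]; omega
    have ih' := ih (J.erase j) (by rw [Finset.card_erase_of_mem hj]; omega)
      (hA.mono (Finset.image_subset_image
        (Finset.sigma_mono (Finset.erase_subset _ _) fun _ => Finset.Subset.refl _)))
    have h1 := card_filter_injOn_union_mul_pow B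
      (Finset.univ.filter fun g : C → Fin q => ∀ i ∈ J.erase j, Set.InjOn g (A i)) (A j \ B) (by
        intro g hg b hb v
        simp only [Finset.mem_filter, Finset.mem_univ, true_and] at hg ⊢
        intro i hi
        refine (hg i hi).congr ?_
        intro a ha
        refine (Function.update_of_ne ?_ _ _).symm
        rintro rfl
        exact (Finset.mem_sdiff.1 (hB hb)).2 (Finset.mem_biUnion.2 ⟨i, hi, ha⟩))
      Finset.sdiff_disjoint (by
        intro g _
        obtain ⟨a, ha⟩ := Finset.card_eq_one.1 hK
        rw [ha]; simp)
    rw [Finset.sdiff_union_of_subset hBA, hBcard, hK, Nat.descFactorial_self,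
      Finset.filter_filter] at h1
    have h2 : (Finset.univ.filter fun g : C → Fin q => ∀ i ∈ J, Set.InjOn g (A i)) =
        Finset.univ.filter fun g : C → Fin q =>
          (∀ i ∈ J.erase j, Set.InjOn g (A i)) ∧ Set.InjOn g (A j) := by
      ext g
      simp only [Finset.mem_filter, Finset.mem_univ, true_and]
      constructor
      · exact fun h => ⟨fun i hi => h i (Finset.mem_of_mem_erase hi), h j hj⟩
      · rintro ⟨h, h'⟩ i hi
        by_cases e : i = j
        · exact e ▸ h'
        · exact h i (Finset.mem_erase.2 ⟨e, hi⟩)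
    rw [h2, pow_succ, mul_comm ((q ^ (q - 1)) ^ n), ← mul_assoc, h1, mul_right_comm, ih']
    ring

/-! ### From colourings to unordered partitions -/

open Classical in
/-- Forgetting the names of the colours identifies at most `q !` surjective colourings. -/
theorem card_le_factorial_mul_card_image_ofSetoid_ker {C : Type*} [Fintype C]
    [DecidableEq C] {q : ℕ} (S : Finset (C → Fin q)) (hS : ∀ g ∈ S, Function.Surjective g) :
    S.card ≤ q ! * (S.image fun g => Finpartition.ofSetoid (Setoid.ker g)).card := by
  classical
  refine Finset.card_le_mul_card_image S (q !) ?_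
  intro P hP
  obtain ⟨g₀, hg₀, rfl⟩ := Finset.mem_image.1 hP
  set T := S.filter fun g => Finpartition.ofSetoid (Setoid.ker g) =
    Finpartition.ofSetoid (Setoid.ker g₀) with hT
  have hker : ∀ g ∈ T, ∀ a b, g₀ a = g₀ b ↔ g a = g b := by
    intro g hg a b
    have e := (Finset.mem_filter.1 hg).2
    have h1 := Finpartition.mem_part_ofSetoid_iff_rel (s := Setoid.ker g) (a := a) (b := b)
    have h2 := Finpartition.mem_part_ofSetoid_iff_rel (s := Setoid.ker g₀) (a := a) (b := b)
    rw [e] at h1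
    rw [Setoid.ker_def] at h1 h2
    exact h2.symm.trans h1
  have hs := Function.surjInv_eq (hS g₀ hg₀)
  have hcomp : ∀ g ∈ T, ∀ a, g (Function.surjInv (hS g₀ hg₀) (g₀ a)) = g a := fun g hg a =>
    (hker g hg _ _).1 (hs (g₀ a))
  have hinj : ∀ g ∈ T, Function.Injective fun v => g (Function.surjInv (hS g₀ hg₀) v) := by
    intro g hg v w h
    have := (hker g hg _ _).2 h
    rwa [hs, hs] at this
  -- Colourings with the kernel of `g₀` are `g₀` followed by an injection of the colours; the `else`
  -- branch is a dummy.
  calc T.card ≤ (Finset.univ : Finset (Fin q ↪ Fin q)).card := by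
        refine Finset.card_le_card_of_injOn
          (fun g => if h : g ∈ T then ⟨_, hinj g h⟩ else Function.Embedding.refl _)
          (fun _ _ => Finset.mem_coe.2 (Finset.mem_univ _)) ?_
        intro g hg g' hg' h
        have hg := Finset.mem_coe.1 hg
        have hg' := Finset.mem_coe.1 hg'
        simp only [hg, hg', dif_pos] at h
        funext a
        have := congrArg (fun k : Fin q ↪ Fin q => k (g₀ a)) h
        simp only [Function.Embedding.coeFn_mk] at this
        rwa [hcomp g hg, hcomp g' hg'] at this
    _ = q ! := by
        rw [Finset.card_univ, Fintype.card_embedding_eq, Fintype.card_fin,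
          Nat.descFactorial_self]

/-! ### Circulations and potentials -/

/-- An edge set at least as large as the set of vertices carries a nonzero circulation. -/
theorem exists_circulation_of_le_card {C R : Type*} [Fintype C] [Fintype R]
    [DecidableEq C] [DecidableEq R] (F : Finset (C × R)) (hF : F.Nonempty)
    (hcard : (F.image Prod.fst).card + (F.image Prod.snd).card ≤ F.card) :
    ∃ h : C → R → ℝ, (∃ i j, h i j ≠ 0) ∧ (∀ i j, h i j ≠ 0 → (i, j) ∈ F) ∧
      (∀ i, ∑ j, h i j = 0) ∧ ∀ j, ∑ i, h i j = 0 := by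
  classical
  obtain ⟨⟨i₀, j₀⟩, h₀⟩ := hF
  set ext : (F → ℝ) → C → R → ℝ := fun u i j => if hij : (i, j) ∈ F then u ⟨(i, j), hij⟩ else 0
    with hext
  have ext_add : ∀ u v i j, ext (u + v) i j = ext u i j + ext v i j := by
    intro u v i j; simp only [hext]; split_ifs <;> simp
  have ext_smul : ∀ (a : ℝ) u i j, ext (a • u) i j = a * ext u i j := by
    intro a u i j; simp only [hext]; split_ifs <;> simp
  let C' := F.image Prod.fst
  -- The equation at `j₀` is redundant, since row sums and column sums have the same total. Dropping
  -- it leaves fewer equations than unknowns.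
  let R' := (F.image Prod.snd).erase j₀
  let T : (F → ℝ) →ₗ[ℝ] (C' → ℝ) × (R' → ℝ) :=
    { toFun := fun u => (fun i => ∑ j, ext u i j, fun j => ∑ i, ext u i j)
      map_add' := by
        intro u v
        ext k <;> simp [ext_add, Finset.sum_add_distrib]
      map_smul' := by
        intro a u
        ext k <;> simp [ext_smul, Finset.mul_sum] }
  have hj₀ : j₀ ∈ F.image Prod.snd := Finset.mem_image_of_mem Prod.snd h₀
  have hlt : Module.finrank ℝ ((C' → ℝ) × (R' → ℝ)) < Module.finrank ℝ (F → ℝ) := by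
    rw [Module.finrank_prod, Module.finrank_fintype_fun_eq_card,
      Module.finrank_fintype_fun_eq_card, Module.finrank_fintype_fun_eq_card,
      Fintype.card_coe, Fintype.card_coe, Fintype.card_coe, Finset.card_erase_of_mem hj₀]
    have := Finset.card_pos.2 ⟨_, hj₀⟩
    simp only [C']
    omega
  obtain ⟨u, hu, hu0⟩ := (Submodule.ne_bot_iff _).1 (LinearMap.ker_ne_bot_of_finrank_lt hlt)
  have hu : T u = 0 := LinearMap.mem_ker.1 hu
  have hz : ∀ i j, (i, j) ∉ F → ext u i j = 0 := fun i j hij => dif_neg hij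
  have hC : ∀ i, ∑ j, ext u i j = 0 := by
    intro i
    by_cases hi : i ∈ C'
    · exact congrFun (congrArg Prod.fst hu) ⟨i, hi⟩
    · exact Finset.sum_eq_zero fun j _ => hz i j fun hij => hi (Finset.mem_image_of_mem Prod.fst hij)
  have hR : ∀ j, j ≠ j₀ → ∑ i, ext u i j = 0 := by
    intro j hj
    by_cases hj' : j ∈ R'
    · exact congrFun (congrArg Prod.snd hu) ⟨j, hj'⟩
    · refine Finset.sum_eq_zero fun i _ => hz i j fun hij => hj' ?_
      exact Finset.mem_erase.2 ⟨hj, Finset.mem_image_of_mem Prod.snd hij⟩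
  refine ⟨ext u, ?_, fun i j h => by_contra fun hij => h (hz i j hij), hC, ?_⟩
  · by_contra! hcon
    refine hu0 (funext fun e => ?_)
    have := hcon e.1.1 e.1.2
    simpa [hext] using this
  · intro j
    by_cases hj : j = j₀
    · subst hj
      have : ∑ j, ∑ i, ext u i j = 0 := by
        rw [Finset.sum_comm]; exact Finset.sum_eq_zero fun i _ => hC i
      rwa [Finset.sum_eq_single j (fun k _ hk => hR k hk) (by simp)] at this
    · exact hR j hj

/-- Weights on an edge set without circulations are differences of vertex potentials. -/
theorem exists_potential_of_no_circulation {C R : Type*} [Fintype C] [Fintype R]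
    [DecidableEq C] [DecidableEq R] (E : Finset (C × R))
    (hE : ∀ h : C → R → ℝ, (∀ i j, h i j ≠ 0 → (i, j) ∈ E) →
      (∀ i, ∑ j, h i j = 0) → (∀ j, ∑ i, h i j = 0) → ∀ i j, h i j = 0)
    (W : C → R → ℝ) :
    ∃ (c : C → ℝ) (Y : R → ℝ), ∀ i j, (i, j) ∈ E → W i j = Y j - c i := by
  classical
  let T : ((C → ℝ) × (R → ℝ)) →ₗ[ℝ] (E → ℝ) :=
    { toFun := fun p e => p.2 e.1.2 - p.1 e.1.1
      map_add' := by intro p r; ext e; simp; ring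
      map_smul' := by intro a p; ext e; simp; ring }
  -- Duality: a functional vanishing on all potential differences, tested on vertex indicators, is a
  -- circulation on `E`, hence zero.
  have htop : LinearMap.range T = ⊤ := by
    by_contra hne
    obtain ⟨ψ, hψ, hle⟩ := Submodule.exists_le_ker_of_lt_top _ (lt_top_iff_ne_top.2 hne)
    apply hψ
    set h : C → R → ℝ := fun i j =>
      if hij : (i, j) ∈ E then ψ (Pi.single ⟨(i, j), hij⟩ 1) else 0 with hh
    have hval : ∀ u : E → ℝ, ψ u = ∑ e : E, u e * h e.1.1 e.1.2 := by
      intro u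
      rw [← LinearMap.sum_single_apply (fun _ => ℝ) u, map_sum]
      refine Finset.sum_congr rfl fun e _ => ?_
      have : Pi.single e (u e) = u e • (Pi.single e (1 : ℝ) : E → ℝ) := by
        rw [← Pi.single_smul]; simp
      simp only [LinearMap.sum_single_apply]
      rw [this, map_smul, smul_eq_mul]
      simp [hh]
    have hsum : ∀ p : C → R → ℝ, ∑ e : E, p e.1.1 e.1.2 * h e.1.1 e.1.2 =
        ∑ i, ∑ j, p i j * h i j := by
      intro p
      rw [← Finset.sum_product' (f := fun i j => p i j * h i j), Finset.univ_product_univ,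
        Finset.sum_coe_sort E (fun e => p e.1 e.2 * h e.1 e.2)]
      refine Finset.sum_subset (Finset.subset_univ _) fun e _ he => ?_
      simp [hh, he]
    have hT : ∀ p, ψ (T p) = 0 := fun p => hle ⟨p, rfl⟩
    have hz := hE h (fun i j hij => by_contra fun hn => hij (dif_neg hn)) (by
        intro i
        have := hT (Pi.single i 1, 0)
        rw [hval] at this
        have h2 := hsum fun i' _ => -(Pi.single i (1 : ℝ) : C → ℝ) i'
        simp only [T, LinearMap.coe_mk, AddHom.coe_mk, Pi.zero_apply, zero_sub] at this
        rw [this] at h2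
        rw [Finset.sum_eq_single i] at h2
        · simpa using h2.symm
        · intro k _ hk
          simp [hk]
        · simp) (by
        intro j
        have := hT (0, Pi.single j 1)
        rw [hval] at this
        have h2 := hsum fun _ j' => (Pi.single j (1 : ℝ) : R → ℝ) j'
        simp only [T, LinearMap.coe_mk, AddHom.coe_mk, Pi.zero_apply, sub_zero] at this
        rw [this, Finset.sum_comm] at h2
        rw [Finset.sum_eq_single j] at h2
        · simpa using h2.symm
        · intro k _ hk
          simp [hk]
        · simp)
    refine LinearMap.ext fun u => ?_
    rw [hval]
    simp [hz]
  obtain ⟨⟨c, Y⟩, hp⟩ := LinearMap.range_eq_top.1 htop fun e => W e.1.1 e.1.2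
  exact ⟨c, Y, fun i j hij => (congrFun hp ⟨(i, j), hij⟩).symm⟩

/-! ### Optimal transport plans -/

/-- The transportation polytope containing the constant matrix `1`. -/
def transportPolytope (C R : Type*) [Fintype C] [Fintype R] : Set (C → R → ℝ) :=
  {f | (∀ i j, 0 ≤ f i j) ∧ (∀ i, ∑ j, f i j = Fintype.card R) ∧
    ∀ j, ∑ i, f i j = Fintype.card C}

theorem transportPolytope.le_card {C R : Type*} [Fintype C] [Fintype R] {f : C → R → ℝ}
    (hf : f ∈ transportPolytope C R) (i : C) (j : R) : f i j ≤ Fintype.card R := by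
  rw [← hf.2.1 i]
  exact Finset.single_le_sum (fun k _ => hf.1 i k) (Finset.mem_univ j)

theorem isCompact_transportPolytope (C R : Type*) [Fintype C] [Fintype R] :
    IsCompact (transportPolytope C R) := by
  have hK : IsCompact (Set.univ.pi fun _ : C => Set.univ.pi fun _ : R =>
      Set.Icc (0 : ℝ) (Fintype.card R)) :=
    isCompact_univ_pi fun _ => isCompact_univ_pi fun _ => isCompact_Icc
  refine hK.of_isClosed_subset ?_ ?_
  · simp only [transportPolytope, Set.ofPred_and, Set.ofPred_forall]
    refine IsClosed.inter ?_ (IsClosed.inter ?_ ?_)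
    · exact isClosed_iInter fun i => isClosed_iInter fun j =>
        isClosed_le continuous_const (by fun_prop)
    · exact isClosed_iInter fun i => isClosed_eq (by fun_prop) continuous_const
    · exact isClosed_iInter fun j => isClosed_eq (by fun_prop) continuous_const
  · intro f hf i _ j _
    exact ⟨hf.1 i j, transportPolytope.le_card hf i j⟩

theorem transportPolytope.add_smul_mem {C R : Type*} [Fintype C] [Fintype R] {f h : C → R → ℝ}
    (hf : f ∈ transportPolytope C R) (hC : ∀ i, ∑ j, h i j = 0) (hR : ∀ j, ∑ i, h i j = 0)
    (t : ℝ) (ht : ∀ i j, 0 ≤ f i j + t * h i j) :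
    (fun i j => f i j + t * h i j) ∈ transportPolytope C R := by
  refine ⟨ht, fun i => ?_, fun j => ?_⟩
  · rw [Finset.sum_add_distrib, ← Finset.mul_sum, hC, hf.2.1]; simp
  · rw [Finset.sum_add_distrib, ← Finset.mul_sum, hR, hf.2.2]; simp

/-- An optimal transport plan whose support carries no circulation. -/
theorem exists_isMaxOn_transportPolytope {C R : Type*} [Fintype C] [Fintype R]
    (W : C → R → ℝ) :
    ∃ f ∈ transportPolytope C R,
      (∀ g ∈ transportPolytope C R, ∑ i, ∑ j, W i j * g i j ≤ ∑ i, ∑ j, W i j * f i j) ∧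
      ∀ h : C → R → ℝ, (∀ i j, h i j ≠ 0 → f i j ≠ 0) →
        (∀ i, ∑ j, h i j = 0) → (∀ j, ∑ i, h i j = 0) → ∀ i j, h i j = 0 := by
  classical
  set obj : (C → R → ℝ) → ℝ := fun f => ∑ i, ∑ j, W i j * f i j with hobj
  set M : Set (C → R → ℝ) := {f | f ∈ transportPolytope C R ∧
    ∀ g ∈ transportPolytope C R, obj g ≤ obj f} with hM
  have hMne : M.Nonempty := by
    obtain ⟨f, hf, hmax⟩ := (isCompact_transportPolytope C R).exists_isMaxOn
      ⟨fun _ _ => 1, by intros; norm_num, by simp, by simp⟩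
      (f := obj) (by fun_prop)
    exact ⟨f, hf, fun g hg => hmax hg⟩
  set supp : (C → R → ℝ) → Finset (C × R) := fun f => Finset.univ.filter fun e => f e.1 e.2 ≠ 0
    with hsupp
  -- Minimal support among optimal plans plays the role of an extreme point.
  set f := Function.argminOn (fun f => (supp f).card) M hMne with hfdef
  have hfM : f ∈ M := Function.argminOn_mem _ _ _
  have hmin : ∀ g ∈ M, (supp f).card ≤ (supp g).card := fun g hg =>
    Function.argminOn_le (fun f => (supp f).card) M hg
  refine ⟨f, hfM.1, hfM.2, ?_⟩
  intro h hhf hC hR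
  by_contra! hne
  obtain ⟨i₁, j₁, h₁⟩ := hne
  obtain ⟨⟨i₀, j₀⟩, he, hle⟩ := Finset.exists_min_image
    (Finset.univ.filter fun e : C × R => h e.1 e.2 ≠ 0) (fun e => f e.1 e.2 / |h e.1 e.2|)
    ⟨(i₁, j₁), by simpa using h₁⟩
  simp only [Finset.mem_filter, Finset.mem_univ, true_and] at he hle
  have hf0 := hfM.1.1
  -- With the minimal ratio, both `f + t h` and `f - t h` stay nonnegative, so by optimality both
  -- have the same value as `f`; the second vanishes at `(i₀, j₀)`, shrinking the support.
  set t := f i₀ j₀ / h i₀ j₀ with ht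
  have hbound : ∀ i j, |t * h i j| ≤ f i j := by
    intro i j
    by_cases hij : h i j = 0
    · simpa [hij] using hf0 i j
    · have := hle (i, j) hij
      rw [abs_mul, ht, abs_div, abs_of_nonneg (hf0 i₀ j₀)]
      exact (le_div_iff₀ (abs_pos.2 hij)).1 this
  have hobj_add : ∀ s : ℝ, obj (fun i j => f i j + s * h i j) = obj f + s * obj h := by
    intro s
    simp only [hobj, Finset.mul_sum, ← Finset.sum_add_distrib]
    exact Finset.sum_congr rfl fun i _ => Finset.sum_congr rfl fun j _ => by ring
  have m1 := transportPolytope.add_smul_mem hfM.1 hC hR t fun i j => by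
    have := (abs_le.1 (hbound i j)).1; linarith
  have m2 := transportPolytope.add_smul_mem hfM.1 hC hR (-t) fun i j => by
    have := (abs_le.1 (hbound i j)).2; linarith
  have o1 := hfM.2 _ m1
  have o2 := hfM.2 _ m2
  have m2M : (fun i j => f i j + -t * h i j) ∈ M := by
    refine ⟨m2, fun g hg => (hfM.2 g hg).trans ?_⟩
    rw [hobj_add] at o1 o2 ⊢
    linarith
  refine absurd (hmin _ m2M) (not_le.2 (Finset.card_lt_card ?_))
  refine Finset.ssubset_iff_subset_ne.2 ⟨?_, fun heq => ?_⟩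
  · intro e
    simp only [hsupp, Finset.mem_filter, Finset.mem_univ, true_and]
    intro hne hz
    by_cases hh : h e.1 e.2 = 0
    · simp [hz, hh] at hne
    · exact hhf _ _ hh hz
  · have : (i₀, j₀) ∈ supp f := by simpa [hsupp] using hhf _ _ he
    rw [← heq] at this
    simp only [hsupp, Finset.mem_filter, Finset.mem_univ, true_and] at this
    apply this
    rw [ht, neg_mul, div_mul_cancel₀ _ he, add_neg_cancel]

/-! ### Tight forests: real, positive and nonnegative matrices -/

/-- For a real matrix with `|R| (q - 1) + 1` columns, some potentials have a tight graph that
contains a forest in which every row has degree `q`. -/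
theorem exists_potential_tight_forest {C R : Type*} [Fintype C] [Fintype R]
    [DecidableEq C] [DecidableEq R] [Nonempty R] {q : ℕ} (hq : 0 < q)
    (hcard : Fintype.card C = Fintype.card R * (q - 1) + 1) (W : C → R → ℝ) :
    ∃ (c : C → ℝ) (Y : R → ℝ) (A : R → Finset C), (∀ i j, c i + W i j ≤ Y j) ∧
      (∀ j, ∀ i ∈ A j, c i + W i j = Y j) ∧ (∀ j, (A j).card = q) ∧
      IsBipartiteForest (((Finset.univ : Finset R).sigma A).image fun p => (p.2, p.1)) := by
  classical
  obtain ⟨f, hf, hmax, hindep⟩ := exists_isMaxOn_transportPolytope W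
  set E : Finset (C × R) := Finset.univ.filter fun e => f e.1 e.2 ≠ 0 with hE
  have memE : ∀ i j, (i, j) ∈ E ↔ f i j ≠ 0 := by intro i j; simp [hE]
  have hRpos : 0 < Fintype.card R := Fintype.card_pos
  -- Entries are at most `|R|` and sum to `|C| > |R| (q - 1)` along row `j`, so more than `q - 1` of
  -- them are nonzero.
  have hdeg : ∀ j, q ≤ (Finset.univ.filter fun i => f i j ≠ 0).card := by
    intro j
    have h1 : (Fintype.card C : ℝ) ≤
        (Finset.univ.filter fun i => f i j ≠ 0).card * Fintype.card R := by
      rw [← hf.2.2 j, ← Finset.sum_filter_ne_zero, ← nsmul_eq_mul]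
      exact Finset.sum_le_card_nsmul _ _ _ fun i _ => transportPolytope.le_card hf i j
    have h2 : Fintype.card R * (q - 1) <
        Fintype.card R * (Finset.univ.filter fun i => f i j ≠ 0).card := by
      rw [mul_comm _ (Finset.card _)]
      have : Fintype.card C ≤
        (Finset.univ.filter fun i => f i j ≠ 0).card * Fintype.card R := by exact_mod_cast h1
      omega
    have := lt_of_mul_lt_mul_left h2 (Nat.zero_le _)
    omega
  have hEcard : Fintype.card R * q ≤ E.card := by
    have : E.card = ∑ j, (Finset.univ.filter fun i => f i j ≠ 0).card := by
      rw [← Finset.card_sigma]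
      refine Finset.card_bij' (fun e _ => ⟨e.2, e.1⟩) (fun p _ => (p.2, p.1)) ?_ ?_ ?_ ?_ <;>
        simp [hE]
    rw [this]
    exact Finset.card_nsmul_le_sum _ _ q fun j _ => hdeg j
  obtain ⟨c, Y, hcY⟩ := exists_potential_of_no_circulation E
    (fun h hh => hindep h fun i j hij => (memE i j).1 (hh i j hij)) W
  choose A hAsub hAcard using fun j => Finset.exists_subset_card_eq (hdeg j)
  have hAE : ∀ j, ∀ i ∈ A j, (i, j) ∈ E := fun j i hi =>
    (memE i j).2 (Finset.mem_filter.1 (hAsub j hi)).2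
  refine ⟨c, Y, A, ?_, fun j i hi => by rw [hcY i j (hAE j i hi)]; ring, hAcard, ?_⟩
  · intro i₀ j₀
    by_cases hmem : (i₀, j₀) ∈ E
    · rw [hcY i₀ j₀ hmem]; linarith
    -- Since `|R| q + 1 = |C| + |R|`, the extra edge forces a circulation, which must use that edge
    -- because `E` carries none.
    obtain ⟨h, ⟨i₁, j₁, h₁⟩, hsub, hC, hR⟩ := exists_circulation_of_le_card (insert (i₀, j₀) E)
      (Finset.insert_nonempty _ _) (by
        rw [Finset.card_insert_of_notMem hmem]
        have a := Finset.card_le_univ ((insert (i₀, j₀) E).image Prod.fst)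
        have b := Finset.card_le_univ ((insert (i₀, j₀) E).image Prod.snd)
        obtain ⟨p, rfl⟩ : ∃ p, q = p + 1 := ⟨q - 1, by omega⟩
        rw [Nat.add_sub_cancel] at hcard
        rw [mul_add, mul_one] at hEcard
        omega)
    have hne : h i₀ j₀ ≠ 0 := by
      intro h0
      refine h₁ (hindep h (fun i j hij => (memE i j).1 ?_) hC hR i₁ j₁)
      rcases Finset.mem_insert.1 (hsub i j hij) with e | e
      · obtain ⟨rfl, rfl⟩ := Prod.mk.inj e
        exact absurd h0 hij
      · exact e
    -- a small positive multiple of the circulation keeps the plan nonnegative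
    obtain ⟨s, hs, hs'⟩ : ∃ s : ℝ, 0 < s * h i₀ j₀ ∧ ∀ i j, 0 ≤ f i j + s * h i j := by
      have hev : ∀ᶠ ε in nhdsWithin (0 : ℝ) (Set.Ioi 0),
          ∀ i j, 0 ≤ f i j + (ε * (h i₀ j₀)⁻¹) * h i j := by
        rw [Filter.eventually_all]; intro i
        rw [Filter.eventually_all]; intro j
        by_cases hij : (i, j) ∈ E
        · have hpos : 0 < f i j := lt_of_le_of_ne (hf.1 i j) ((memE i j).1 hij).symm
          have hcont : Filter.Tendsto (fun ε : ℝ => f i j + (ε * (h i₀ j₀)⁻¹) * h i j)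
              (nhdsWithin 0 (Set.Ioi 0)) (nhds (f i j + (0 * (h i₀ j₀)⁻¹) * h i j)) :=
            (Continuous.tendsto (by fun_prop) 0).mono_left nhdsWithin_le_nhds
          have := hcont.eventually_const_lt (u := 0) (by simpa using hpos)
          exact this.mono fun ε hε => hε.le
        · filter_upwards [self_mem_nhdsWithin] with ε hε
          by_cases h0 : h i j = 0
          · simpa [h0] using hf.1 i j
          rcases Finset.mem_insert.1 (hsub i j h0) with e | e
          · obtain ⟨rfl, rfl⟩ := Prod.mk.inj e
            rw [mul_assoc, inv_mul_cancel₀ hne, mul_one]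
            exact add_nonneg (hf.1 i j) (le_of_lt hε)
          · exact absurd e hij
      obtain ⟨ε, hε, hε'⟩ := (hev.and self_mem_nhdsWithin).exists
      refine ⟨ε * (h i₀ j₀)⁻¹, ?_, hε⟩
      rw [mul_assoc, inv_mul_cancel₀ hne, mul_one]
      exact hε'
    have hopt := hmax _ (transportPolytope.add_smul_mem hf hC hR s hs')
    have e1 : ∑ i, ∑ j, W i j * (f i j + s * h i j) =
        ∑ i, ∑ j, W i j * f i j + s * ∑ i, ∑ j, W i j * h i j := by
      simp only [Finset.mul_sum, ← Finset.sum_add_distrib]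
      exact Finset.sum_congr rfl fun i _ => Finset.sum_congr rfl fun j _ => by ring
    -- Potentials pair to zero with a circulation, so `W` may be replaced by its reduced weight;
    -- that vanishes on `E`, leaving only the term of the new edge.
    have e2 : ∑ i, ∑ j, W i j * h i j = ∑ i, ∑ j, (W i j - (Y j - c i)) * h i j := by
      have ey : ∑ i, ∑ j, Y j * h i j = 0 := by
        rw [Finset.sum_comm]
        exact Finset.sum_eq_zero fun j _ => by rw [← Finset.mul_sum, hR, mul_zero]
      have ec : ∑ i, ∑ j, c i * h i j = 0 :=
        Finset.sum_eq_zero fun i _ => by rw [← Finset.mul_sum, hC, mul_zero]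
      simp only [sub_mul, Finset.sum_sub_distrib, ey, ec]
      ring
    have e3 : ∑ i, ∑ j, (W i j - (Y j - c i)) * h i j =
        (W i₀ j₀ - (Y j₀ - c i₀)) * h i₀ j₀ := by
      have hz : ∀ i j, (i, j) ≠ (i₀, j₀) → (W i j - (Y j - c i)) * h i j = 0 := by
        intro i j hij
        by_cases h0 : h i j = 0
        · rw [h0, mul_zero]
        · rw [hcY i j ((Finset.mem_insert.1 (hsub i j h0)).resolve_left hij), sub_self, zero_mul]
      rw [Finset.sum_eq_single i₀, Finset.sum_eq_single j₀]
      · exact fun j _ hj => hz _ _ fun e => hj (Prod.mk.inj e).2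
      · simp
      · exact fun i _ hi => Finset.sum_eq_zero fun j _ => hz _ _ fun e => hi (Prod.mk.inj e).1
      · simp
    rw [e1, e2, e3] at hopt
    have : (W i₀ j₀ - (Y j₀ - c i₀)) * (s * h i₀ j₀) ≤ 0 := by nlinarith
    have := nonpos_of_mul_nonpos_left this hs
    linarith
  · intro F hF hFne
    by_contra! hcon
    obtain ⟨h, ⟨i₁, j₁, h₁⟩, hsub, hC, hR⟩ := exists_circulation_of_le_card F hFne hcon
    refine h₁ (hindep h (fun i j hij => (memE i j).1 ?_) hC hR i₁ j₁)
    obtain ⟨⟨j', i'⟩, hp, e⟩ := Finset.mem_image.1 (hF (hsub i j hij))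
    obtain ⟨rfl, rfl⟩ := Prod.mk.inj e
    exact hAE _ _ (Finset.mem_sigma.1 hp).2

/-- The tight forest for a real matrix in multiplicative form. -/
theorem exists_tight_forest_of_pos {C R : Type*} [Fintype C] [Fintype R]
    [DecidableEq C] [DecidableEq R] {q : ℕ} (hq : 0 < q)
    (hcard : Fintype.card C = Fintype.card R * (q - 1) + 1) (X : C → R → ℝ)
    (hX : ∀ i j, 0 < X i j) (j₀ : R) :
    ∃ (c : C → ℝ) (Y : R → ℝ) (A : R → Finset C), (∀ i, 0 ≤ c i) ∧ Y j₀ = 1 ∧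
      (∀ i j, c i * X i j ≤ Y j) ∧
      (∀ j, ∀ i ∈ A j, c i * X i j = Y j) ∧ (∀ j, (A j).card = q) ∧
      IsBipartiteForest (((Finset.univ : Finset R).sigma A).image fun p => (p.2, p.1)) := by
  have : Nonempty R := ⟨j₀⟩
  obtain ⟨c, Y, A, hle, heq, hA, hforest⟩ :=
    exists_potential_tight_forest hq hcard fun i j => Real.log (X i j)
  have hmul : ∀ i j, Real.exp (c i - Y j₀) * X i j =
      Real.exp (c i + Real.log (X i j) - Y j₀) := by
    intro i j
    rw [← Real.exp_log (hX i j), ← Real.exp_add, Real.log_exp]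
    ring_nf
  refine ⟨fun i => Real.exp (c i - Y j₀), fun j => Real.exp (Y j - Y j₀), A,
    fun i => (Real.exp_pos _).le, by simp, fun i j => ?_, fun j i hi => ?_, hA, hforest⟩
  · simp only [hmul]
    exact Real.exp_le_exp.2 (by linarith [hle i j])
  · simp only [hmul]
    rw [heq j i hi]

/-- The tight forest for a nonnegative matrix with a row of ones. -/
theorem exists_tight_forest_of_nonneg {C R : Type*} [Fintype C] [Fintype R]
    [DecidableEq C] [DecidableEq R] {q : ℕ} (hq : 0 < q)
    (hcard : Fintype.card C = Fintype.card R * (q - 1) + 1) (X : C → R → ℝ)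
    (hX : ∀ i j, 0 ≤ X i j) (j₀ : R) (hj₀ : ∀ i, X i j₀ = 1) :
    ∃ (c : C → ℝ) (Y : R → ℝ) (A : R → Finset C), (∀ i, 0 ≤ c i) ∧ Y j₀ = 1 ∧
      (∀ i j, c i * X i j ≤ Y j) ∧
      (∀ j, ∀ i ∈ A j, c i * X i j = Y j) ∧ (∀ j, (A j).card = q) ∧
      IsBipartiteForest (((Finset.univ : Finset R).sigma A).image fun p => (p.2, p.1)) := by
  classical
  -- Lift the zeros to `1 / (n + 1)`, which is at most 1 and so preserves the row of ones. That row
  -- bounds `c` by 1, and tight columns then bound `Y`, giving compactness.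
  set Xn : ℕ → C → R → ℝ := fun n i j => max (X i j) (1 / ((n : ℝ) + 1)) with hXn
  have hpos : ∀ n i j, 0 < Xn n i j := fun n i j => lt_max_of_lt_right (by positivity)
  have hone : ∀ n i, Xn n i j₀ = 1 := by
    intro n i
    simp only [hXn, hj₀]
    refine max_eq_left ?_
    rw [div_le_one (by positivity)]
    linarith [(Nat.cast_nonneg n : (0 : ℝ) ≤ n)]
  obtain ⟨K, hK⟩ : ∃ K, ∀ i j, X i j ≤ K := by
    obtain ⟨K, hK⟩ := (Set.finite_range fun p : C × R => X p.1 p.2).bddAbove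
    exact ⟨K, fun i j => hK ⟨(i, j), rfl⟩⟩
  have hXle : ∀ n i j, Xn n i j ≤ |K| + 1 := by
    intro n i j
    refine max_le ((hK i j).trans ((le_abs_self K).trans (by linarith))) ?_
    have : 1 / ((n : ℝ) + 1) ≤ 1 := by
      rw [div_le_one (by positivity)]
      linarith [(Nat.cast_nonneg n : (0 : ℝ) ≤ n)]
    linarith [abs_nonneg K]
  choose c Y A hc hY hle heq hA hforest using fun n =>
    exists_tight_forest_of_pos hq hcard (Xn n) (hpos n) j₀
  have hc1 : ∀ n i, c n i ≤ 1 := fun n i => by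
    have := hle n i j₀
    rwa [hone, mul_one, hY] at this
  have hY0 : ∀ n j, Y n j ∈ Set.Icc 0 (|K| + 1) := by
    intro n j
    obtain ⟨i, hi⟩ := Finset.card_pos.1 ((hA n j).symm ▸ hq)
    rw [← heq n j i hi]
    refine ⟨mul_nonneg (hc n i) (hpos n i j).le, ?_⟩
    calc c n i * Xn n i j ≤ 1 * Xn n i j :=
          mul_le_mul_of_nonneg_right (hc1 n i) (hpos n i j).le
      _ ≤ |K| + 1 := by rw [one_mul]; exact hXle n i j
  -- Along an ultrafilter all the bounded sequences converge at once, and `A`, having finitely many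
  -- possible values, is eventually constant.
  let U : Ultrafilter ℕ := Filter.hyperfilter ℕ
  have hU : (U : Filter ℕ) ≤ Filter.atTop := by
    rw [← Nat.cofinite_eq_atTop]; exact Filter.hyperfilter_le_cofinite
  obtain ⟨A', hA'⟩ : ∃ A', ∀ᶠ n in (U : Filter ℕ), A n = A' := by
    obtain ⟨A', hA'⟩ := Ultrafilter.eq_pure_of_finite (U.map A)
    refine ⟨A', ?_⟩
    have : ({A'} : Set (R → Finset C)) ∈ U.map A := by rw [hA']; exact Set.mem_singleton _
    exact this
  have hlimc : ∀ i, ∃ l, Filter.Tendsto (fun n => c n i) U (nhds l) := by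
    intro i
    obtain ⟨l, -, hl⟩ := (isCompact_Icc (a := (0 : ℝ)) (b := 1)).ultrafilter_le_nhds'
      (U.map fun n => c n i) (Filter.Eventually.of_forall (f := (U : Filter ℕ)) fun n => ⟨hc n i, hc1 n i⟩)
    exact ⟨l, hl⟩
  have hlimY : ∀ j, ∃ l, Filter.Tendsto (fun n => Y n j) U (nhds l) := by
    intro j
    obtain ⟨l, -, hl⟩ := (isCompact_Icc (a := (0 : ℝ)) (b := |K| + 1)).ultrafilter_le_nhds'
      (U.map fun n => Y n j) (Filter.Eventually.of_forall (f := (U : Filter ℕ)) fun n => hY0 n j)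
    exact ⟨l, hl⟩
  choose c' hc' using hlimc
  choose Y' hY' using hlimY
  have hlimX : ∀ i j, Filter.Tendsto (fun n => Xn n i j) U (nhds (X i j)) := by
    intro i j
    have h := (tendsto_const_nhds (x := X i j)).max (tendsto_one_div_add_atTop_nhds_zero_nat (𝕜 := ℝ))
    rw [max_eq_left (hX i j)] at h
    exact h.mono_left hU
  obtain ⟨n₀, hn₀⟩ := hA'.exists
  refine ⟨c', Y', A', fun i => ge_of_tendsto' (hc' i) fun n => hc n i, ?_, fun i j => ?_,
    fun j i hi => ?_, hn₀ ▸ hA n₀, hn₀ ▸ hforest n₀⟩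
  · refine tendsto_nhds_unique (hY' j₀) ?_
    simp only [hY]
    exact tendsto_const_nhds
  · exact le_of_tendsto_of_tendsto' ((hc' i).mul (hlimX i j)) (hY' j) fun n => hle n i j
  · refine tendsto_nhds_unique_of_eventuallyEq ((hc' i).mul (hlimX i j)) (hY' j) ?_
    filter_upwards [hA'] with n hn
    exact heq n j i (hn ▸ hi)

/-! ### Exponential coordinates on the max-plus line -/

/-- The exponential `RMax → ℝ`, with value `0` at `-∞`. -/
noncomputable def RMax.exp : RMax → ℝ
  | ⊥ => 0
  | (a : ℝ) => Real.exp a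

/-- The logarithm `ℝ → RMax`, with value `-∞` on nonpositive reals. -/
noncomputable def RMax.log (t : ℝ) : RMax := if 0 < t then (Real.log t : ℝ) else ⊥

theorem RMax.exp_bot : RMax.exp ⊥ = 0 := rfl

theorem RMax.exp_coe (a : ℝ) : RMax.exp (a : RMax) = Real.exp a := rfl

theorem RMax.exp_nonneg (a : RMax) : 0 ≤ RMax.exp a := by
  induction a using WithBot.recBotCoe with
  | bot => exact le_rfl
  | coe a => exact (Real.exp_pos a).le

theorem RMax.exp_log {t : ℝ} (ht : 0 ≤ t) : RMax.exp (RMax.log t) = t := by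
  unfold RMax.log
  split_ifs with h
  · exact Real.exp_log h
  · exact le_antisymm ht (not_lt.1 h)

theorem RMax.exp_add (a b : RMax) : RMax.exp (a + b) = RMax.exp a * RMax.exp b := by
  induction a using WithBot.recBotCoe with
  | bot => rw [WithBot.bot_add, RMax.exp_bot, zero_mul]
  | coe a =>
    induction b using WithBot.recBotCoe with
    | bot => rw [WithBot.add_bot, RMax.exp_bot, mul_zero]
    | coe b => rw [← WithBot.coe_add, RMax.exp_coe, RMax.exp_coe, RMax.exp_coe, Real.exp_add]

theorem RMax.strictMono_exp : StrictMono RMax.exp := by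
  intro a b h
  induction b using WithBot.recBotCoe with
  | bot => exact absurd h not_lt_bot
  | coe b =>
    induction a using WithBot.recBotCoe with
    | bot => exact Real.exp_pos b
    | coe a => exact Real.exp_lt_exp.2 (WithBot.coe_lt_coe.1 h)

/-- A point lies in the hull of `x i`, `i ∈ s`, if it dominates suitable translates and each
coordinate, as well as the normalisation, is attained in `s`. -/
theorem mem_mpconv_of_attained {ι : Type*} {d : ℕ} {s : Finset ι} {x : ι → Fin d → RMax}
    {y : Fin d → RMax} (c : ι → RMax) (hc : ∀ i, c i ≤ 0) (hc' : ∃ i ∈ s, c i = 0)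
    (hle : ∀ i j, c i + x i j ≤ y j) (hy : ∀ j, ∃ i ∈ s, c i + x i j = y j) :
    y ∈ mpconv s x := by
  refine ⟨c, le_antisymm (Finset.sup_le fun i _ => hc i) ?_,
    fun j => le_antisymm ?_ (Finset.sup_le fun i _ => hle i j)⟩
  · obtain ⟨i, hi, h⟩ := hc'
    exact h ▸ Finset.le_sup hi
  · obtain ⟨i, hi, h⟩ := hy j
    rw [← h]
    exact Finset.le_sup (f := fun i => c i + x i j) hi

/-! ### Tverberg partitions from rainbow colourings -/

/-- Lower bound on the number of max-plus Tverberg partitions of a family indexed by `C`. -/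
theorem factorial_pow_le_ncard_isMPTverbergPartition {C : Type*} [Fintype C] [DecidableEq C]
    {q d : ℕ} (hq : 0 < q) (hcard : Fintype.card C = (d + 1) * (q - 1) + 1)
    (x : C → Fin d → RMax) :
    ((q - 1)!) ^ d ≤
      Set.ncard {P : Finpartition (Finset.univ : Finset C) | IsMPTverbergPartition q x P} := by
  classical
  -- The row `none` is the homogenising coordinate: tightness there, with `Y none = 1`, is the
  -- normalisation that the largest coefficient is 0.
  obtain ⟨c, Y, A, hc, hY, hle, heq, hA, hforest⟩ :=
    exists_tight_forest_of_nonneg (C := C) (R := Option (Fin d)) (q := q) hq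
      (by simpa using hcard)
      (fun i j => j.elim 1 fun k => RMax.exp (x i k))
      (fun i j => by cases j <;> simp [RMax.exp_nonneg]) none (fun i => rfl)
  have hcount := IsBipartiteForest.card_rainbow_mul_pow A hq hA _ Finset.univ rfl hforest
  set G := Finset.univ.filter fun g : C → Fin q => ∀ j ∈ Finset.univ, Set.InjOn g (A j) with hG
  have hsurj : ∀ g ∈ G, ∀ j l, ∃ i ∈ A j, g i = l := by
    intro g hg j l
    have hinj := (Finset.mem_filter.1 hg).2 j (Finset.mem_univ j)
    have : (A j).image g = Finset.univ := by
      rw [← Finset.card_eq_iff_eq_univ, Finset.card_image_of_injOn hinj, hA, Fintype.card_fin]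
    have hl : l ∈ (A j).image g := this ▸ Finset.mem_univ l
    simpa using hl
  have hsurj' : ∀ g ∈ G, Function.Surjective g := fun g hg l =>
    (hsurj g hg none l).imp fun _ h => h.2
  -- As `|C| = (d + 1) (q - 1) + 1`, cancelling the powers of `q` leaves one factor `q`, which turns
  -- one `(q - 1)!` into `q !`.
  have hGcard : G.card = q ! * ((q - 1)!) ^ d := by
    obtain ⟨p, rfl⟩ : ∃ p, q = p + 1 := ⟨q - 1, by omega⟩
    simp only [Finset.card_univ, Fintype.card_option, Fintype.card_fin, hcard,
      Nat.add_sub_cancel] at hcount ⊢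
    rw [← pow_mul, mul_comm p (d + 1), pow_succ (p + 1), ← mul_assoc,
      mul_right_comm] at hcount
    have := Nat.eq_of_mul_eq_mul_right (by positivity) hcount
    rw [hG]
    simp only [Finset.mem_univ, forall_true_left] at this ⊢
    rw [this, Nat.factorial_succ]
    ring
  have hle1 := card_le_factorial_mul_card_image_ofSetoid_ker G hsurj'
  rw [hGcard] at hle1
  refine (Nat.le_of_mul_le_mul_left hle1 (Nat.factorial_pos q)).trans ?_
  rw [← Set.ncard_coe_finset]
  refine Set.ncard_le_ncard (fun P hP => ?_) (Set.toFinite _)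
  obtain ⟨g, hg, rfl⟩ := Finset.mem_image.1 (Finset.mem_coe.1 hP)
  have hparts : (Finpartition.ofSetoid (Setoid.ker g)).parts =
      Finset.univ.image fun l => Finset.univ.filter fun i => g i = l := by
    have h : (Finpartition.ofSetoid (Setoid.ker g)).parts =
        Finset.univ.image fun a => Finset.univ.filter fun b => g a = g b := by
      refine Finset.image_congr fun a _ => Finset.filter_congr fun b _ => Iff.rfl
    rw [h]
    ext s
    simp only [Finset.mem_image, Finset.mem_univ, true_and]
    constructor
    · rintro ⟨a, rfl⟩
      exact ⟨g a, by simp only [eq_comm]⟩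
    · rintro ⟨l, rfl⟩
      obtain ⟨a, rfl⟩ := hsurj' g hg l
      exact ⟨a, by simp only [eq_comm]⟩
  refine ⟨?_, fun k => RMax.log (Y (some k)), ?_⟩
  · rw [hparts, Finset.card_image_of_injective, Finset.card_univ, Fintype.card_fin]
    intro l l' h
    obtain ⟨i, rfl⟩ := hsurj' g hg l
    have : i ∈ Finset.univ.filter fun i' => g i' = g i := by simp
    rw [show (Finset.univ.filter fun i' => g i' = g i) = Finset.univ.filter fun i' => g i' = l'
      from h] at this
    exact (Finset.mem_filter.1 this).2
  intro s hs
  rw [hparts] at hs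
  obtain ⟨l, -, rfl⟩ := Finset.mem_image.1 hs
  have hYnn : ∀ j, 0 ≤ Y j := by
    intro j
    obtain ⟨i⟩ : Nonempty C := Fintype.card_pos_iff.1 (by omega)
    refine (mul_nonneg (hc i) ?_).trans (hle i j)
    cases j <;> simp [RMax.exp_nonneg]
  have hexp0 : RMax.exp 0 = 1 := by
    rw [← WithBot.coe_zero, RMax.exp_coe, Real.exp_zero]
  -- The same coefficients serve every colour class; rainbowness on `A j` supplies a tight point of
  -- each class.
  refine mem_mpconv_of_attained (fun i => RMax.log (c i)) (fun i => ?_) ?_ (fun i k => ?_)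
    fun k => ?_
  · rw [← RMax.strictMono_exp.le_iff_le, RMax.exp_log (hc i), hexp0]
    simpa [hY] using hle i none
  · obtain ⟨i, hi, rfl⟩ := hsurj g hg none l
    refine ⟨i, by simp, RMax.strictMono_exp.injective ?_⟩
    rw [RMax.exp_log (hc i), hexp0]
    simpa [hY] using heq none i hi
  · rw [← RMax.strictMono_exp.le_iff_le, RMax.exp_add, RMax.exp_log (hc i),
      RMax.exp_log (hYnn _)]
    exact hle i (some k)
  · obtain ⟨i, hi, rfl⟩ := hsurj g hg (some k) l
    refine ⟨i, by simp, RMax.strictMono_exp.injective ?_⟩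
    rw [RMax.exp_add, RMax.exp_log (hc i), RMax.exp_log (hYnn _)]
    exact heq (some k) i hi

theorem mainTheorem2 (q d : ℕ) (hq : 2 ≤ q) (hd : 1 ≤ d)
    (x : Fin ((d + 1) * (q - 1) + 1) → Fin d → RMax) :
    ((q - 1)!) ^ d ≤
      Set.ncard {P : Finpartition (Finset.univ : Finset (Fin ((d + 1) * (q - 1) + 1))) |
        IsMPTverbergPartition q x P} := by
  exact factorial_pow_le_ncard_isMPTverbergPartition (by omega) (Fintype.card_fin _) x
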